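/- Let $\Lambda$ be an artin algebra, i.e. an algebra over a commutative artinian ring $R$ that is finitely generated as an $R$-module, and let $\operatorname{mod}\Lambda$ be the abelian category of finitely generated left $\Lambda$-modules. Let $d\ge 0$ be an integer and assume: (a) $\Lambda$ is $d$-Gorenstein: the injective dimensions $\operatorname{id}({}_\Lambda\Lambda)$ and $\operatorname{id}(\Lambda_\Lambda)$ of $\Lambda$ as a left and as a right module over itself are both finite, with common value $d$ (where the zero module has injective dimension $0$). (b) $\Lambda$ is of finite Cohen–Macaulay type. Here $G\in\operatorname{mod}\Lambda$ is called Gorenstein-projective if there is an exact sequence $\cdots\to P_1\to P_0\to P_{-1}\to\cdots$ of projective objects of $\operatorname{mod}\Lambda$ that remains exact under $\operatorname{Hom}_\Lambda(-,Q)$ for every projective object $Q$ of $\operatorname{mod}\Lambda$ and satisfies $G\cong\operatorname{Ker}(P_0\to P_{-1})$; $\operatorname{Gproj}\Lambda$ denotes the full subcategory of these modules; and finite Cohen–Macaulay type means that there is $M\in\operatorname{Gproj}\Lambda$ with $\operatorname{add}(\operatorname{Gproj}\Lambda)=\operatorname{add}M$, where $\operatorname{add}\mathcal X$ consists of the direct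 summands of finite direct sums of objects of $\mathcal X$. Then $$\operatorname{der.dim}\Lambda\le\max\{2,d\}.$$ Here $\operatorname{der.dim}\Lambda$ is the dimension of the triangulated category $\mathcal T=\mathbb D^b(\operatorname{mod}\Lambda)$, the bounded derived category of $\operatorname{mod}\Lambda$: the infimum of the integers $n\ge 0$ such that $\mathcal T=\langle M\rangle_{n+1}$ for some object $M$ of $\mathcal T$ (and $\infty$ if there are none), where $\langle M\rangle_1=\langle M\rangle$ is the closure of $M$ under finite direct sums, direct summands and shifts, and, for $n\ge 1$, $\langle M\rangle_{n+1}$ is the closure under the same operations of the class of objects $X$ that occur in a distinguished triangle $I_1\to X\to I_2\to I_1[1]$ with $I_1\in\langle M\rangle_{n}$ and $I_2\in\langle M\rangle$. -/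

import Mathlib

open CategoryTheory CategoryTheory.Limits

universe w v u

/-- A ring `Λ` is an artin algebra if it is an algebra over some commutative artinian ring `R`
and is finitely generated as an `R`-module. (Replacing `R` by its image in `Λ`, it does not matter
in which universe `R` is sought, see `IsArtinAlgebra.of_finite`.) -/
class IsArtinAlgebra (Λ : Type u) [Ring Λ] : Prop where
  exists_finite : ∃ (R : Type u) (_ : CommRing R) (_ : Algebra R Λ),
    IsArtinianRing R ∧ Module.Finite R Λ

theorem IsArtinAlgebra.of_finite (R : Type v) [CommRing R] [IsArtinianRing R]
    (Λ : Type u) [Ring Λ] [Algebra R Λ] [Module.Finite R Λ] : IsArtinAlgebra Λ where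
  exists_finite := by
    let : CommRing (⊥ : Subalgebra R Λ) :=
      { (inferInstance : Ring (⊥ : Subalgebra R Λ)) with
        mul_comm := by
          rintro ⟨x, hx⟩ ⟨y, hy⟩
          obtain ⟨r, rfl⟩ := Algebra.mem_bot.1 hx
          exact Subtype.ext (Algebra.commutes r y) }
    let : Algebra (⊥ : Subalgebra R Λ) Λ :=
      { algebraMap := (⊥ : Subalgebra R Λ).val.toRingHom
        smul := fun x y => x.1 * y
        smul_def' := fun _ _ => rfl
        commutes' := by
          rintro ⟨x, hx⟩ y
          obtain ⟨r, rfl⟩ := Algebra.mem_bot.1 hx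
          exact Algebra.commutes r y }
    have : IsScalarTower R (⊥ : Subalgebra R Λ) Λ :=
      ⟨fun r x y => Algebra.smul_mul_assoc r x.1 y⟩
    refine ⟨(⊥ : Subalgebra R Λ), inferInstance, inferInstance, ?_, ?_⟩
    · exact Function.Surjective.isArtinianRing
        (f := algebraMap R (⊥ : Subalgebra R Λ)) (by
          rintro ⟨x, hx⟩
          obtain ⟨r, rfl⟩ := Algebra.mem_bot.1 hx
          exact ⟨r, rfl⟩)
    · exact Module.Finite.of_restrictScalars_finite R _ _

instance IsArtinAlgebra.isNoetherianRing (Λ : Type u) [Ring Λ] [h : IsArtinAlgebra Λ] :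
    IsNoetherianRing Λ := by
  obtain ⟨R, _, _, _, _⟩ := h.exists_finite
  exact isNoetherian_of_tower R (inferInstance : IsNoetherian R Λ)

/-- An artin algebra `Λ` is `d`-Gorenstein if the injective dimensions of `Λ` as a left module
and as a right module over itself are both finite and have the common value `d`. -/
structure IsGorensteinOfDim (Λ : Type u) [Ring Λ] (d : ℕ) : Prop where
  left : IsLeast {n : ℕ | HasInjectiveDimensionLE (ModuleCat.of Λ Λ) n} d
  right : IsLeast {n : ℕ | HasInjectiveDimensionLE (ModuleCat.of Λᵐᵒᵖ Λ) n} d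

section Abelian

variable {A : Type u} [Category.{v} A] [Abelian A]

attribute [local instance] Abelian.hasFiniteBiproducts

/-- `add 𝒳`: the objects that are isomorphic to a direct summand of a finite direct sum of
objects in `𝒳`. -/
def addClosure (𝒳 : ObjectProperty A) : ObjectProperty A := fun X =>
  ∃ (n : ℕ) (F : Fin n → A), (∀ i, 𝒳 (F i)) ∧ Nonempty (Retract X (⨁ F))

/-- `𝒳` is representation-finite if `add 𝒳 = add M` for some object `M` in `𝒳`. -/
def IsRepresentationFinite (𝒳 : ObjectProperty A) : Prop :=
  ∃ M : A, 𝒳 M ∧ addClosure 𝒳 = addClosure (ObjectProperty.singleton M)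

/-- `G` is Gorenstein-projective: there is an exact sequence
`⋯ ⟶ P₁ ⟶ P₀ ⟶ P₋₁ ⟶ ⋯` of projective objects which remains exact under `Hom(-, Q)` for every
projective object `Q`, and `G ≅ Ker (P₀ ⟶ P₋₁)`. -/
def IsGorensteinProjective : ObjectProperty A := fun G =>
  ∃ P : ChainComplex A ℤ,
    (∀ n : ℤ, Projective (P.X n)) ∧ P.Acyclic ∧
    (∀ Q : A, Projective Q → ∀ (n : ℤ) (f : P.X n ⟶ Q), P.d (n + 1) n ≫ f = 0 →
      ∃ g : P.X (n - 1) ⟶ Q, P.d n (n - 1) ≫ g = f) ∧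
    Nonempty (G ≅ kernel (P.d 0 (-1)))

end Abelian

/-- An artin algebra `Λ` is of finite Cohen-Macaulay type if the full subcategory `Gproj Λ` of
Gorenstein-projective objects of the category `mod Λ` of finitely generated `Λ`-modules is
representation-finite. -/
def IsFiniteCMType (Λ : Type u) [Ring Λ] [IsNoetherianRing Λ] : Prop :=
  IsRepresentationFinite (IsGorensteinProjective (A := FGModuleCat.{u} Λ))

/-- The dimension of a triangulated category `T`: the infimum of the `d` such that
`T = ⟨M⟩_{d+1}` for some object `M` (and `∞` if there is no such `d`). The property
`(ObjectProperty.singleton M).triangEnvelopeIter d` is `⟨M⟩_{d+1}`: for `d = 0` it is the closure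
of `M` under shifts, finite direct sums and direct summands, and each further step takes
extensions by distinguished triangles and then direct summands. -/
noncomputable def triangulatedDim (T : Type u) [Category.{v} T] [HasZeroObject T] [HasShift T ℤ]
    [Preadditive T] [∀ n : ℤ, (shiftFunctor T n).Additive] [Pretriangulated T] : ℕ∞ :=
  ⨅ (d : ℕ) (_ : ∃ M : T, (ObjectProperty.singleton M).triangEnvelopeIter d = ⊤), (d : ℕ∞)

/-- The derived dimension of `Λ`: the dimension of the bounded derived category of the abelian
category `mod Λ` of finitely generated `Λ`-modules. -/
noncomputable def derDim (Λ : Type u) [Ring Λ] [IsNoetherianRing Λ]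
    [HasDerivedCategory.{w} (FGModuleCat.{u} Λ)] : ℕ∞ :=
  triangulatedDim (DerivedCategory.Bounded (FGModuleCat.{u} Λ))

/-!
For `k : ℕ` let `E k` be the class of finitely generated modules `X` with `Ext^i(X, Λ) = 0` for all
`i > k`. The proof has two independent parts.

*Modules in `E 0` are Gorenstein-projective*
(`isGorensteinProjective_of_fgExtVanishesAbove`). If `X` is in `E 0`, so is the kernel of any
epimorphism from a free module to `X`, and morphisms from that kernel to `Λ` extend to the free
module. In the other direction, finite injective dimension of `Λ` as a right module makes
`Ext^i(Hom(X, Λ), Λ)` vanish for `i > 0` (`subsingleton_ext_dual`), and then `X` is torsionless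
(`eq_zero_of_forall_dual`). So a map `X ⟶ Λᵏ` through which all functionals of `X` factor is
injective, and its cokernel is in `E 0` again. Splicing both kinds of sequences gives a complete
resolution of `X`. If `Λ` is of finite Cohen-Macaulay type, it follows that `E 0` lies in `add G` for
a single module `G`.

*The bound follows from formal properties of the classes `E k`* (`triangEnvelopeIter_eq_top`). A
syzygy of a module in `E (k + 1)` is in `E k`, and all modules are in `E n` for `n = max 2 d`. Take a
bounded complex. Covering it by contractible complexes of projectives replaces it, up to shift, by
its `n`-th syzygy, a complex with terms in `E 0` (`hasLevel_of_terms`). The cycles of such a complex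
are second syzygies of cokernels, and lie in `E (n - 2)`. Attach projectives that map onto the
cycles, that is, form the cone of a morphism from a complex of projectives with zero differential:
this replaces the cycles by their syzygies and costs one level (`hasLevel_of_cycles`). After `n - 2`
steps the terms and the cycles both lie in `E 0`, and such a complex is built from three complexes
with zero differential and terms in `E 0` (`hasLevel_two`). A bounded complex with zero differential
and terms in `add G` is in `⟨G⟩`, so all objects are in `⟨G⟩_{n+1}`.
-/

/-! ### Images of properties of objects under functors -/

section Retracts

variable {T D : Type*} [Category T] [Category D]

theorem prop_map_shift [HasShift T ℤ] [HasShift D ℤ] (F : T ⥤ D) [F.CommShift ℤ]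
    {P : ObjectProperty T} [P.IsStableUnderShift ℤ] {X : D} (hX : P.map F X) (n : ℤ) :
    P.map F (X⟦n⟧) := by
  obtain ⟨Y, hY, ⟨e⟩⟩ := (P.prop_map_iff F _).1 hX
  exact (P.prop_map_iff F _).2 ⟨Y⟦n⟧, P.le_shift n _ hY,
    ⟨(F.commShiftIso n).app Y ≪≫ (shiftFunctor D n).mapIso e⟩⟩

/-- The image of a property under a fully faithful functor need not be closed under retracts,
because the functor need not have retract-closed image: `X` has to come from `T`. -/
theorem prop_map_retract (F : T ⥤ D) [F.Full] [F.Faithful] {P : ObjectProperty T}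
    [P.IsStableUnderRetracts] {X Y : D} (r : Retract X Y) (hY : P.map F Y)
    (hX : F.essImage X) : P.map F X := by
  obtain ⟨Y', hY', ⟨e⟩⟩ := (P.prop_map_iff F _).1 hY
  obtain ⟨X', ⟨e'⟩⟩ := hX
  refine (P.prop_map_iff F _).2 ⟨X', P.prop_of_retract (Y := Y')
    ⟨F.preimage (e'.hom ≫ r.i ≫ e.inv), F.preimage (e.hom ≫ r.r ≫ e'.inv), ?_⟩ hY', ⟨e'⟩⟩
  apply F.map_injective
  simp

/-- `X` is a retract of a biproduct as soon as its identity is a sum of two composites. -/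
noncomputable def retractOfTotal [Preadditive D] {X X₁ X₂ : D} [HasBinaryBiproduct X₁ X₂]
    (p₁ : X ⟶ X₁) (i₁ : X₁ ⟶ X) (p₂ : X ⟶ X₂) (i₂ : X₂ ⟶ X) (h : p₁ ≫ i₁ + p₂ ≫ i₂ = 𝟙 X) :
    Retract X (X₁ ⊞ X₂) where
  i := biprod.lift p₁ p₂
  r := biprod.desc i₁ i₂
  retract := by simpa using h

end Retracts

/-! ### Levels of the filtration by `⟨M⟩` inside a larger triangulated category -/

section Triangulated

open ZeroObject Pretriangulated

variable {T D : Type*} [Category T] [Category D] [HasZeroObject T] [HasZeroObject D]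
  [HasShift T ℤ] [HasShift D ℤ] [Preadditive T] [Preadditive D]
  [∀ n : ℤ, (shiftFunctor T n).Additive] [∀ n : ℤ, (shiftFunctor D n).Additive]
  [Pretriangulated T] [Pretriangulated D]

/-- A full triangulated functor lifts the connecting morphism of a distinguished triangle, hence
the whole triangle, as soon as the outer objects lie in its image. -/
theorem prop_map_extensionProduct (F : T ⥤ D) [F.CommShift ℤ] [F.IsTriangulated] [F.Full]
    {P Q : ObjectProperty T} {X : Triangle D} (hX : X ∈ distTriang D)
    (h₁ : P.map F X.obj₁) (h₃ : Q.map F X.obj₃) :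
    (P.extensionProduct Q).map F X.obj₂ := by
  obtain ⟨X₁, hX₁, ⟨e₁⟩⟩ := (P.prop_map_iff F _).1 h₁
  obtain ⟨X₃, hX₃, ⟨e₃⟩⟩ := (Q.prop_map_iff F _).1 h₃
  obtain ⟨h, hh⟩ := F.map_surjective (e₃.hom ≫ X.mor₃ ≫ e₁.inv⟦1⟧' ≫
    (F.commShiftIso (1 : ℤ)).inv.app X₁)
  obtain ⟨X₂, f, g, H⟩ := distinguished_cocone_triangle₂ h
  refine (ObjectProperty.prop_map_iff _ F _).2 ⟨X₂, ⟨X₁, X₃, f, g, h, H, hX₁, hX₃⟩,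
    ⟨Triangle.π₂.mapIso (isoTriangleOfIso₁₃ _ _ (F.map_distinguished _ H) hX e₁ e₃ ?_)⟩⟩
  change (F.map h ≫ (F.commShiftIso (1 : ℤ)).hom.app X₁) ≫ e₁.hom⟦1⟧' = e₃.hom ≫ X.mor₃
  simp [hh, ← Functor.map_comp]

variable (P : ObjectProperty T)

theorem prop_biprod_triangEnvelopeIter_zero {X Y : T} (hX : P.triangEnvelopeIter 0 X)
    (hY : P.triangEnvelopeIter 0 Y) : P.triangEnvelopeIter 0 (X ⊞ Y) := by
  rw [ObjectProperty.triangEnvelopeIter_zero] at *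
  obtain ⟨X', hX', ⟨r⟩⟩ := hX
  obtain ⟨Y', hY', ⟨s⟩⟩ := hY
  have h : (P.shiftClosure ℤ).binaryProductsClosure (X' ⨯ Y') :=
    ObjectProperty.prop_prod _ _ _ hX' hY'
  refine ⟨X' ⨯ Y', h, ⟨⟨biprod.map r.i s.i ≫ (biprod.isoProd X' Y').hom,
    (biprod.isoProd X' Y').inv ≫ biprod.map r.r s.r, ?_⟩⟩⟩
  rw [Category.assoc, Iso.hom_inv_id_assoc]
  ext <;> simp

theorem prop_zero_triangEnvelopeIter [P.Nonempty] {X : T} (hX : IsZero X) (n : ℕ) :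
    P.triangEnvelopeIter n X := by
  obtain ⟨Y, hY⟩ := ‹P.Nonempty›
  exact ObjectProperty.prop_of_retract _ (Y := Y) ⟨0, 0, hX.eq_of_src _ _⟩
    (P.le_triangEnvelopeIter n _ hY)

/-- The objects of `D` isomorphic to the image of an object of `⟨M⟩_{n+1}`. It allows for working
with triangles of the unbounded derived category while measuring levels in the bounded one. -/
abbrev imageLevel (F : T ⥤ D) (M : T) (n : ℕ) : ObjectProperty D :=
  ((ObjectProperty.singleton M).triangEnvelopeIter n).map F

variable (F : T ⥤ D) [F.CommShift ℤ] (M : T)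

variable [F.IsTriangulated]

theorem imageLevel_biprod {X Y : D} (hX : imageLevel F M 0 X) (hY : imageLevel F M 0 Y) :
    imageLevel F M 0 (X ⊞ Y) := by
  have := preservesBinaryBiproducts_of_preservesBinaryProducts F
  obtain ⟨X', hX', ⟨e⟩⟩ := (ObjectProperty.prop_map_iff _ F _).1 hX
  obtain ⟨Y', hY', ⟨e'⟩⟩ := (ObjectProperty.prop_map_iff _ F _).1 hY
  exact (ObjectProperty.prop_map_iff _ F _).2 ⟨X' ⊞ Y',
    prop_biprod_triangEnvelopeIter_zero _ hX' hY', ⟨F.mapBiprod X' Y' ≪≫ biprod.mapIso e e'⟩⟩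

theorem imageLevel_zero {X : D} (hX : IsZero X) (n : ℕ) : imageLevel F M n X :=
  (ObjectProperty.prop_map_iff _ F _).2 ⟨(0 : T), prop_zero_triangEnvelopeIter _ (isZero_zero T) n,
    ⟨(F.map_isZero (isZero_zero T)).iso hX⟩⟩

variable [F.Full]

theorem imageLevel_succ_of_distTriang {n : ℕ} {X : Triangle D} (hX : X ∈ distTriang D)
    (h₁ : imageLevel F M 0 X.obj₁) (h₃ : imageLevel F M n X.obj₃) :
    imageLevel F M (n + 1) X.obj₂ := by
  refine ObjectProperty.map_monotone ?_ F _ (prop_map_extensionProduct F hX h₁ h₃)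
  rw [ObjectProperty.triangEnvelopeIter_succ, ObjectProperty.triangEnvelopeIter_zero]
  exact ObjectProperty.le_retractClosure _

theorem imageLevel_succ_of_distTriang' [IsTriangulated T] {n : ℕ} {X : Triangle D}
    (hX : X ∈ distTriang D)
    (h₁ : imageLevel F M n X.obj₁) (h₃ : imageLevel F M 0 X.obj₃) :
    imageLevel F M (n + 1) X.obj₂ := by
  refine ObjectProperty.map_monotone ?_ F _ (prop_map_extensionProduct F hX h₁ h₃)
  rw [ObjectProperty.triangEnvelopeIter_succ', ObjectProperty.triangEnvelopeIter_zero]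
  exact ObjectProperty.le_retractClosure _

end Triangulated

/-! ### Bounded complexes and complexes with zero differential -/

section Complexes

variable {A : Type u} [Category.{v} A] [Abelian A]

/-- A cochain complex with only finitely many nonzero terms. -/
def IsBoundedComplex (C : CochainComplex A ℤ) : Prop :=
  ∃ a b : ℤ, ∀ i, i < a ∨ b < i → IsZero (C.X i)

theorem IsBoundedComplex.of_isZero {C D : CochainComplex A ℤ} (hC : IsBoundedComplex C)
    (h : ∀ i, IsZero (C.X i) → IsZero (D.X i)) : IsBoundedComplex D := by
  obtain ⟨a, b, hab⟩ := hC
  exact ⟨a, b, fun i hi => h i (hab i hi)⟩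

/-- The cochain complex with given terms and zero differential. -/
def zeroDiff (Y : ℤ → A) : CochainComplex A ℤ where
  X := Y
  d _ _ := 0

@[simp]
theorem zeroDiff_d (Y : ℤ → A) (i j : ℤ) : (zeroDiff Y).d i j = 0 := rfl

/-- The morphism of complexes with zero differential given by a family of morphisms. -/
def zeroDiffMap {Y Y' : ℤ → A} (f : ∀ i, Y i ⟶ Y' i) : zeroDiff Y ⟶ zeroDiff Y' where
  f := f
  comm' _ _ _ := comp_zero.trans zero_comp.symm

open ZeroObject in
/-- Splitting off the term in degree `c` of a complex with zero differential. -/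
theorem zeroDiff_total (Y : ℤ → A) (c : ℤ) : ∃ (p₁ : zeroDiff Y ⟶
      zeroDiff (fun i => if i = c then 0 else Y i))
    (i₁ : zeroDiff (fun i => if i = c then 0 else Y i) ⟶ zeroDiff Y)
    (p₂ : zeroDiff Y ⟶ (HomologicalComplex.single A (ComplexShape.up ℤ) c).obj ((zeroDiff Y).X c))
    (i₂ : (HomologicalComplex.single A (ComplexShape.up ℤ) c).obj ((zeroDiff Y).X c) ⟶ zeroDiff Y),
    p₁ ≫ i₁ + p₂ ≫ i₂ = 𝟙 _ := by
  let f (i : ℤ) : Y i ⟶ (if i = c then 0 else Y i) :=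
    if h : i = c then 0 else eqToHom (by simp [h])
  let g (i : ℤ) : (if i = c then 0 else Y i) ⟶ Y i :=
    if h : i = c then 0 else eqToHom (by simp [h])
  have hfg (i : ℤ) : f i ≫ g i = if i = c then 0 else 𝟙 (Y i) := by
    by_cases h : i = c <;> simp [f, g, h]
  refine ⟨zeroDiffMap f, zeroDiffMap g,
    HomologicalComplex.mkHomToSingle (K := zeroDiff Y) (A := (zeroDiff Y).X c) (𝟙 _)
      (by simp),
    HomologicalComplex.mkHomFromSingle (K := zeroDiff Y) (A := (zeroDiff Y).X c) (𝟙 _)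
      (by simp), ?_⟩
  ext i
  have hi : (zeroDiffMap f).f i ≫ (zeroDiffMap g).f i = _ := hfg i
  rw [HomologicalComplex.add_f_apply, HomologicalComplex.comp_f, HomologicalComplex.comp_f, hi]
  by_cases h : i = c
  · subst h
    rw [HomologicalComplex.mkHomToSingle_f, HomologicalComplex.mkHomFromSingle_f, if_pos rfl]
    exact (zero_add _).trans (by simp)
  · rw [(HomologicalComplex.isZero_single_obj_X (ComplexShape.up ℤ) c
      ((zeroDiff Y).X c) i h).eq_of_tgt
      (HomologicalComplex.Hom.f (HomologicalComplex.mkHomToSingle _ _) i) 0, zero_comp, if_neg h]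
    exact add_zero _

variable [HasDerivedCategory.{w} A]

open DerivedCategory

theorem IsBoundedComplex.bounded {C : CochainComplex A ℤ} (hC : IsBoundedComplex C) :
    (TStructure.t : Triangulated.TStructure (DerivedCategory A)).bounded (Q.obj C) := by
  obtain ⟨a, b, hab⟩ := hC
  have : C.IsStrictlyGE a := (C.isStrictlyGE_iff a).2 fun i hi => hab i (.inl hi)
  have : C.IsStrictlyLE b := (C.isStrictlyLE_iff b).2 fun i hi => hab i (.inr hi)
  exact ⟨⟨a, inferInstanceAs ((Q.obj C).IsGE a)⟩, ⟨b, inferInstanceAs ((Q.obj C).IsLE b)⟩⟩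

theorem IsBoundedComplex.mem_essImage {C : CochainComplex A ℤ} (hC : IsBoundedComplex C) :
    (Bounded.ι (C := A)).essImage (Q.obj C) :=
  ⟨⟨Q.obj C, hC.bounded⟩, ⟨Iso.refl _⟩⟩

theorem exists_isBoundedComplex (X : Bounded A) :
    ∃ C : CochainComplex A ℤ, IsBoundedComplex C ∧ Nonempty (Bounded.ι.obj X ≅ Q.obj C) := by
  obtain ⟨X, ⟨a, ha⟩, ⟨b, hb⟩⟩ := X
  obtain ⟨K, _, _, e⟩ := exists_iso_Q_obj_of_isGE_of_isLE X a b
  refine ⟨K, ⟨a, b, ?_⟩, e⟩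
  rintro i (hi | hi)
  · exact K.isZero_of_isStrictlyGE a i hi
  · exact K.isZero_of_isStrictlyLE b i hi

/-- The complex `C` is isomorphic in the derived category to an object of `⟨M⟩_{n+1}`. -/
abbrev HasLevel (M : Bounded A) (n : ℕ) (C : CochainComplex A ℤ) : Prop :=
  imageLevel (Bounded.ι (C := A)) M n (Q.obj C)

variable {M : Bounded A}

theorem HasLevel.of_shortExact {S : ShortComplex (CochainComplex A ℤ)} (hS : S.ShortExact) {n : ℕ}
    (h₁ : HasLevel M 0 S.X₁) (h₃ : HasLevel M n S.X₃) : HasLevel M (n + 1) S.X₂ :=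
  imageLevel_succ_of_distTriang _ _ (triangleOfSES_distinguished hS) h₁ h₃

open Pretriangulated in
theorem HasLevel.of_shortExact_left {S : ShortComplex (CochainComplex A ℤ)} (hS : S.ShortExact)
    {n : ℕ} (h₂ : HasLevel M n S.X₂) (h₃ : HasLevel M 0 S.X₃) : HasLevel M (n + 1) S.X₁ :=
  imageLevel_succ_of_distTriang _ _ (inv_rot_of_distTriang _ (triangleOfSES_distinguished hS))
    (prop_map_shift _ h₃ (-1)) h₂

open Pretriangulated in
/-- If the middle term is acyclic, the last term is a shift of the first. -/
theorem HasLevel.of_shortExact_of_isZero {S : ShortComplex (CochainComplex A ℤ)}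
    (hS : S.ShortExact) {n : ℕ} (h₁ : HasLevel M n S.X₁) (h₂ : IsZero (Q.obj S.X₂)) :
    HasLevel M n S.X₃ := by
  have : IsIso (triangleOfSESδ hS) :=
    ((triangleOfSES hS).isZero₂_iff_isIso₃ (triangleOfSES_distinguished hS)).1 h₂
  exact ObjectProperty.prop_of_iso (imageLevel _ M n) (asIso (triangleOfSESδ hS)).symm
    (prop_map_shift _ h₁ 1)

theorem hasLevel_single {X : A}
    (hX : imageLevel (Bounded.ι (C := A)) M 0 ((singleFunctor A 0).obj X)) (c : ℤ) :
    HasLevel M 0 ((HomologicalComplex.single A (ComplexShape.up ℤ) c).obj X) := by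
  have := prop_map_shift _ hX (-c)
  refine ObjectProperty.prop_of_iso (imageLevel _ M 0) ?_ this
  exact ((singleFunctors A).shiftIso (-c) c 0 (by omega)).app X ≪≫
    (singleFunctorIsoCompQ A c).app X

/-- A bounded complex with zero differential is a finite sum of shifts of its terms, so it lies in
`⟨M⟩` if its terms do. -/
theorem hasLevel_zeroDiff (Y : ℤ → A)
    (hY : ∀ i, imageLevel (Bounded.ι (C := A)) M 0 ((singleFunctor A 0).obj (Y i)))
    (hb : IsBoundedComplex (zeroDiff Y)) : HasLevel M 0 (zeroDiff Y) := by
  obtain ⟨a, b, hab⟩ := hb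
  obtain ⟨n, hn⟩ : ∃ n : ℕ, b < a + n := ⟨(b + 1 - a).toNat, by omega⟩
  replace hab : ∀ i, i < a ∨ a + n ≤ i → IsZero (Y i) := fun i hi => hab i (by omega)
  clear hn
  induction n generalizing Y with
  | zero =>
    refine imageLevel_zero _ _ (Functor.map_isZero _ ?_) 0
    rw [IsZero.iff_id_eq_zero]
    ext i
    exact (hab i (by push_cast; omega)).eq_of_src _ _
  | succ n ih =>
    obtain ⟨p₁, i₁, p₂, i₂, h⟩ := zeroDiff_total Y (a + n)
    refine prop_map_retract _ (retractOfTotal (Q.map p₁) (Q.map i₁) (Q.map p₂) (Q.map i₂)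
      (by rw [← Functor.map_comp, ← Functor.map_comp, ← Functor.map_add, h,
        CategoryTheory.Functor.map_id]))
      (imageLevel_biprod _ _ (ih _ ?_ ?_) (hasLevel_single (hY _) _))
      (IsBoundedComplex.mem_essImage ⟨a, a + n, fun i hi => hab i (by push_cast; omega)⟩)
    · intro i
      split_ifs
      · exact imageLevel_zero _ _ (Functor.map_isZero _ (isZero_zero _)) 0
      · exact hY i
    · intro i hi
      split_ifs with h'
      · exact isZero_zero _
      · exact hab i (by push_cast; omega)

end Complexes

/-! ### Cones of morphisms from complexes with zero differential -/

section Attach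

variable {A : Type u} [Category.{v} A] [Abelian A]

/-- The short exact sequence `0 ⟶ kernel d ⟶ X ⟶ Y ⟶ 0` given by an epi-mono factorization
`X ⟶ Y ⟶ Z` of `d`. -/
theorem shortExact_kernel_of_fac {X Y Z : A} {d : X ⟶ Z} {g : X ⟶ Y} {m : Y ⟶ Z} [Epi g] [Mono m]
    (h : d = g ≫ m) : ∃ w, (ShortComplex.mk (kernel.ι d) g w).ShortExact := by
  have w : kernel.ι d ≫ g = 0 := by
    rw [← cancel_mono m, Category.assoc, ← h, kernel.condition, zero_comp]
  exact ⟨w,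
    { exact := ShortComplex.exact_of_f_is_kernel _
        (KernelFork.IsLimit.ofι' _ w fun k hk =>
          ⟨kernel.lift d k (by rw [h, ← Category.assoc, hk, zero_comp]), kernel.lift_ι _ _ _⟩)
      mono_f := inferInstanceAs (Mono (kernel.ι d))
      epi_g := ‹Epi g› }⟩

/-- The mapping cone of a morphism `s` to `C` from the complex with zero differential and
terms `S i`: its term in degree `i` is `S (i + 1) ⊞ C.X i`. -/
noncomputable def attach (C : CochainComplex A ℤ) (S : ℤ → A) (s : ∀ i, S i ⟶ C.X i)
    (hs : ∀ i, s i ≫ C.d i (i + 1) = 0) : CochainComplex A ℤ :=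
  CochainComplex.of (fun i => S (i + 1) ⊞ C.X i)
    (fun i => biprod.desc (s (i + 1)) (C.d i (i + 1)) ≫ biprod.inr)
    (fun i => by ext <;> simp [hs])

variable (C : CochainComplex A ℤ) (S : ℤ → A) (s : ∀ i, S i ⟶ C.X i)
  (hs : ∀ i, s i ≫ C.d i (i + 1) = 0)

theorem attach_d (i : ℤ) : (attach C S s hs).d i (i + 1) =
    (biprod.desc (s (i + 1)) (C.d i (i + 1)) ≫ biprod.inr :
      S (i + 1) ⊞ C.X i ⟶ S (i + 1 + 1) ⊞ C.X (i + 1)) :=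
  CochainComplex.of_d (fun i => S (i + 1) ⊞ C.X i)
    (fun i => biprod.desc (s (i + 1)) (C.d i (i + 1)) ≫ biprod.inr) i

/-- The inclusion of a complex into a cone. -/
noncomputable def attachInr : C ⟶ attach C S s hs where
  f i := (biprod.inr : C.X i ⟶ S (i + 1) ⊞ C.X i)
  comm' := by
    rintro i _ rfl
    rw [attach_d]
    exact biprod.inr_desc_assoc _ _ _

/-- The projection from a cone to the shifted source. -/
noncomputable def attachFst : attach C S s hs ⟶ zeroDiff (fun i => S (i + 1)) where
  f i := (biprod.fst : S (i + 1) ⊞ C.X i ⟶ S (i + 1))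
  comm' := by
    rintro i _ rfl
    rw [attach_d, zeroDiff_d]
    exact comp_zero.trans (by simp : (biprod.desc (s (i + 1)) (C.d i (i + 1)) ≫ biprod.inr :
      S (i + 1) ⊞ C.X i ⟶ S (i + 1 + 1) ⊞ C.X (i + 1)) ≫ biprod.fst = 0).symm

theorem attach_zero : attachInr C S s hs ≫ attachFst C S s hs = 0 := by
  ext i
  exact (biprod.inr_fst : (biprod.inr : C.X i ⟶ S (i + 1) ⊞ C.X i) ≫ biprod.fst = 0)

theorem attach_shortExact :
    (ShortComplex.mk _ _ (attach_zero C S s hs)).ShortExact :=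
  HomologicalComplex.shortExact_of_degreewise_shortExact _ fun i =>
    { exact := ShortComplex.exact_of_f_is_kernel _
          (biprod.isKernelFstKernelFork (S (i + 1)) (C.X i))
      mono_f := inferInstanceAs (Mono (biprod.inr : C.X i ⟶ S (i + 1) ⊞ C.X i))
      epi_g := inferInstanceAs (Epi (biprod.fst : S (i + 1) ⊞ C.X i ⟶ S (i + 1))) }

theorem isBoundedComplex_attach (hC : IsBoundedComplex C)
    (hS : ∀ i, IsZero (C.X i) → IsZero (S i)) : IsBoundedComplex (attach C S s hs) := by
  obtain ⟨a, b, hab⟩ := hC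
  refine ⟨a - 1, b, fun i hi => ?_⟩
  exact (biprod_isZero_iff _ _).2 ⟨hS _ (hab _ (by omega)), hab _ (by omega)⟩

/-- If `q` is an epimorphism onto the cycles, the cycles of the cone are the first term of a short
exact sequence with last term the cycles of `C` in the next degree. -/
theorem attach_cycles_shortExact (q : ∀ i, S i ⟶ kernel (C.d i (i + 1))) [∀ i, Epi (q i)]
    (hq : ∀ i, q i ≫ kernel.ι _ = s i) (i : ℤ) :
    ∃ T : ShortComplex A, T.ShortExact ∧ T.X₁ = kernel ((attach C S s hs).d i (i + 1)) ∧
      T.X₂ = (S (i + 1) ⊞ C.X i) ∧ T.X₃ = kernel (C.d (i + 1) (i + 1 + 1)) := by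
  let g : S (i + 1) ⊞ C.X i ⟶ kernel (C.d (i + 1) (i + 1 + 1)) :=
    biprod.desc (q (i + 1)) (kernel.lift _ (C.d i (i + 1)) (by simp))
  have hd : (biprod.desc (s (i + 1)) (C.d i (i + 1)) ≫ biprod.inr :
      S (i + 1) ⊞ C.X i ⟶ S (i + 1 + 1) ⊞ C.X (i + 1)) = g ≫ kernel.ι _ ≫ biprod.inr := by
    rw [← Category.assoc]
    congr 1
    ext <;> simp [g, hq]
  have : Epi (biprod.inl ≫ g) := by simpa [g] using inferInstanceAs (Epi (q (i + 1)))
  have := epi_of_epi biprod.inl g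
  obtain ⟨_, hw⟩ := shortExact_kernel_of_fac hd
  refine ⟨_, hw, ?_, rfl, rfl⟩
  rw [attach_d]
  rfl

end Attach

/-! ### Contractible complexes -/

section Disk

variable {A : Type u} [Category.{v} A]

/-- The clause on zero objects keeps complexes built from such covers bounded. -/
theorem exists_projective_epi [HasZeroMorphisms A] [EnoughProjectives A] (X : A) :
    ∃ (P : A) (π : P ⟶ X), Projective P ∧ Epi π ∧ (IsZero X → IsZero P) := by
  by_cases hX : IsZero X
  · exact ⟨X, 𝟙 X, hX.projective, inferInstance, id⟩
  · exact ⟨Projective.over X, Projective.π X, inferInstance, inferInstance, fun h => (hX h).elim⟩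

variable [Abelian A]

/-- The contractible complex with terms `N (i + 1) ⊞ N i`. -/
noncomputable abbrev diskSum (N : ℤ → A) : CochainComplex A ℤ :=
  attach (zeroDiff N) N (fun i => 𝟙 (N i)) (fun _ => comp_zero)

theorem diskSum_d (N : ℤ → A) (i : ℤ) : (diskSum N).d i (i + 1) =
    (biprod.fst ≫ biprod.inr : N (i + 1) ⊞ N i ⟶ N (i + 1 + 1) ⊞ N (i + 1)) := by
  refine (attach_d _ _ _ _ i).trans ?_
  change (biprod.desc (𝟙 _) 0 ≫ biprod.inr : N (i + 1) ⊞ N i ⟶ N (i + 1 + 1) ⊞ N (i + 1)) = _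
  refine biprod.hom_ext' _ _ ?_ ?_ <;> simp

theorem diskSum_acyclic (N : ℤ → A) : (diskSum N).Acyclic := by
  intro j
  obtain ⟨i, rfl⟩ : ∃ i, j = i + 1 := ⟨j - 1, by omega⟩
  rw [HomologicalComplex.exactAt_iff' _ i (i + 1) (i + 1 + 1) (by simp) (by simp),
    ShortComplex.exact_iff_exact_up_to_refinements]
  intro B x hx
  change B ⟶ N (i + 1 + 1) ⊞ N (i + 1) at x
  replace hx : x ≫ (biprod.fst ≫ biprod.inr :
      N (i + 1 + 1) ⊞ N (i + 1) ⟶ N (i + 1 + 1 + 1) ⊞ N (i + 1 + 1)) = 0 :=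
    (congrArg (fun t => x ≫ t) (diskSum_d N (i + 1))).symm.trans hx
  replace hx : x ≫ biprod.fst = 0 := by
    have := hx =≫ biprod.snd
    rwa [Category.assoc, Category.assoc, biprod.inr_snd, Category.comp_id, zero_comp] at this
  let y : B ⟶ N (i + 1) ⊞ N i := x ≫ biprod.snd ≫ biprod.inl
  refine ⟨B, 𝟙 B, inferInstance, y, ?_⟩
  refine Eq.trans ?_ (congrArg (fun t => y ≫ t) (diskSum_d N i)).symm
  change 𝟙 B ≫ x = y ≫ (biprod.fst ≫ biprod.inr :
    N (i + 1) ⊞ N i ⟶ N (i + 1 + 1) ⊞ N (i + 1))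
  refine biprod.hom_ext _ _ ?_ ?_ <;> simp [hx, y]

theorem isZero_Q_obj_of_acyclic [HasDerivedCategory.{w} A] {K : CochainComplex A ℤ}
    (hK : K.Acyclic) : IsZero (DerivedCategory.Q.obj K) := by
  have : K.IsGE 1 := (K.isGE_iff 1).2 fun i _ => hK i
  have : K.IsLE 0 := (K.isLE_iff 0).2 fun i _ => hK i
  exact (DerivedCategory.TStructure.t (C := A)).isZero _ 0 1

/-- Every family of epimorphisms onto the terms of `C` extends to an epimorphism onto `C` from a
sum of disks. -/
theorem exists_diskSum_epi (C : CochainComplex A ℤ) (R : ℤ → A) (π : ∀ i, R i ⟶ C.X i)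
    [∀ i, Epi (π i)] :
    ∃ f : diskSum (fun i => R (i - 1)) ⟶ C, ∀ i, Epi (f.f i) := by
  let a (i : ℤ) : R (i + 1 - 1) ⟶ C.X i := eqToHom (by simp) ≫ π i
  let b (i : ℤ) : R (i - 1) ⟶ C.X i := π (i - 1) ≫ C.d (i - 1) i
  have hab (i : ℤ) : b (i + 1) = a i ≫ C.d i (i + 1) := by
    have h (k : ℤ) (hk : k = i) :
        π k ≫ C.d k (i + 1) = (eqToHom (by rw [hk]) ≫ π i) ≫ C.d i (i + 1) := by
      subst hk; simp
    exact h _ (by simp)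
  have hb (i : ℤ) : b i ≫ C.d i (i + 1) = 0 := by simp [b]
  refine ⟨{ f := fun i => (biprod.desc (a i) (b i) : R (i + 1 - 1) ⊞ R (i - 1) ⟶ C.X i)
            comm' := ?_ }, fun i => ?_⟩
  · rintro i _ rfl
    refine Eq.trans ?_ (congrArg (fun t => t ≫ (biprod.desc (a (i + 1)) (b (i + 1)) :
      R (i + 1 + 1 - 1) ⊞ R (i + 1 - 1) ⟶ C.X (i + 1)))
      (diskSum_d (fun i => R (i - 1)) i)).symm
    change (biprod.desc (a i) (b i) : R (i + 1 - 1) ⊞ R (i - 1) ⟶ C.X i) ≫ C.d i (i + 1) =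
      (biprod.fst ≫ biprod.inr :
        R (i + 1 - 1) ⊞ R (i - 1) ⟶ R (i + 1 + 1 - 1) ⊞ R (i + 1 - 1)) ≫
      biprod.desc (a (i + 1)) (b (i + 1))
    refine biprod.hom_ext' _ _ ?_ ?_
    · simp [hab]
    · simp [hb]
  · have : Epi (biprod.inl ≫ biprod.desc (a i) (b i)) := by
      rw [biprod.inl_desc]; infer_instance
    have := epi_of_epi biprod.inl (biprod.desc (a i) (b i))
    exact this

theorem isBoundedComplex_diskSum {C : CochainComplex A ℤ} (hC : IsBoundedComplex C) (R : ℤ → A)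
    (hR : ∀ i, IsZero (C.X i) → IsZero (R i)) :
    IsBoundedComplex (diskSum (fun i => R (i - 1))) := by
  obtain ⟨a, b, hab⟩ := hC
  refine ⟨a, b + 1, fun i hi => ?_⟩
  exact (biprod_isZero_iff _ _).2 ⟨hR _ (hab _ (by omega)), hR _ (hab _ (by omega))⟩

end Disk

/-! ### The bound in terms of a syzygy filtration -/

section Bound

variable {A : Type u} [Category.{v} A] [Abelian A]

/-- A sequence of classes of objects which behaves like "being of relative dimension at most `k`"
under passing to syzygies. -/
structure IsSyzygyFiltration (E : ℕ → ObjectProperty A) : Prop where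
  projective {P : A} (hP : Projective P) : E 0 P
  biprod {X Y : A} (hX : E 0 X) (hY : E 0 Y) : E 0 (X ⊞ Y)
  of_shortExact {S : ShortComplex A} (hS : S.ShortExact) {k : ℕ} (h₂ : E 0 S.X₂)
    (h₃ : E (k + 1) S.X₃) : E k S.X₁

variable {E : ℕ → ObjectProperty A} [HasDerivedCategory.{w} A] {M : DerivedCategory.Bounded A}

open DerivedCategory

/-- Up to a shift in the derived category, a bounded complex may be replaced by its `n`-th syzygy
with respect to contractible complexes of projectives, whose terms lie in `E 0`. -/
theorem hasLevel_of_terms (hE : IsSyzygyFiltration E) [EnoughProjectives A] {l : ℕ}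
    (h : ∀ C : CochainComplex A ℤ, IsBoundedComplex C → (∀ i, E 0 (C.X i)) → HasLevel M l C)
    (n : ℕ) (C : CochainComplex A ℤ) (hC : IsBoundedComplex C) (hn : ∀ i, E n (C.X i)) :
    HasLevel M l C := by
  induction n generalizing C with
  | zero => exact h C hC hn
  | succ n ih =>
    choose R π hR hπ hz using fun i => exists_projective_epi (C.X i)
    obtain ⟨f, hf⟩ := exists_diskSum_epi C R π
    have : Epi f := HomologicalComplex.epi_of_epi_f _ hf
    let S := ShortComplex.mk (kernel.ι f) f (kernel.condition f)
    have hS : S.ShortExact :=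
      { exact := ShortComplex.exact_of_f_is_kernel _ (kernelIsKernel f) }
    have hi := (HomologicalComplex.shortExact_iff_degreewise_shortExact S).1 hS
    refine HasLevel.of_shortExact_of_isZero hS (ih _ ?_ fun i => ?_)
      (isZero_Q_obj_of_acyclic (diskSum_acyclic fun i => R (i - 1)))
    · refine (isBoundedComplex_diskSum hC R hz).of_isZero fun i hi' => ?_
      have : Mono ((kernel.ι f).f i) := (hi i).mono_f
      exact IsZero.of_mono ((kernel.ι f).f i) hi'
    · exact hE.of_shortExact (hi i) (hE.biprod (hE.projective (hR _)) (hE.projective (hR _))) (hn i)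

/-- Let `C` be a bounded complex whose terms `C.X i` and cycles `Z i` lie in `E 0`. The cycles form a
subcomplex of `C`, and both it and the quotient have zero differential. The quotient in turn is the
cone of the inclusion `Z ⟶ C` of graded objects. Thus `C` is built from three complexes with zero
differential and terms in `E 0`. -/
theorem hasLevel_two (hM : ∀ X, E 0 X →
      imageLevel (Bounded.ι (C := A)) M 0 ((singleFunctor A 0).obj X))
    (C : CochainComplex A ℤ) (hC : IsBoundedComplex C)
    (h₀ : ∀ i, E 0 (C.X i)) (hZ : ∀ i, E 0 (kernel (C.d i (i + 1)))) : HasLevel M 2 C := by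
  let ι (i : ℤ) := kernel.ι (C.d i (i + 1))
  let f₁ : zeroDiff (fun i => kernel (C.d i (i + 1))) ⟶ C :=
    { f := ι
      comm' := by
        rintro i _ rfl
        rw [zeroDiff_d]
        exact (kernel.condition (C.d i (i + 1))).trans zero_comp.symm }
  let g₁ : C ⟶ zeroDiff (fun i => cokernel (ι i)) :=
    { f := fun i => cokernel.π (ι i)
      comm' := by
        rintro i _ rfl
        rw [zeroDiff_d]
        refine comp_zero.trans ?_
        have : C.d i (i + 1) = kernel.lift (C.d (i + 1) (i + 1 + 1)) (C.d i (i + 1)) (by simp) ≫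
          ι (i + 1) := by simp [ι]
        change 0 = C.d i (i + 1) ≫ cokernel.π (ι (i + 1))
        rw [this, Category.assoc, cokernel.condition, comp_zero] }
  have hι (i : ℤ) : (ShortComplex.mk (ι i) (cokernel.π (ι i)) (cokernel.condition _)).ShortExact :=
    { exact := ShortComplex.exact_of_g_is_cokernel _ (cokernelIsCokernel (ι i))
      mono_f := inferInstanceAs (Mono (kernel.ι _)) }
  have w₁ : f₁ ≫ g₁ = 0 := by
    ext i
    exact cokernel.condition (ι i)
  have w₂ : zeroDiffMap ι ≫ zeroDiffMap (fun i => cokernel.π (ι i)) = 0 := by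
    ext i
    exact cokernel.condition (ι i)
  have hS₁ : (ShortComplex.mk f₁ g₁ w₁).ShortExact :=
    HomologicalComplex.shortExact_of_degreewise_shortExact _ hι
  have hS₂ : (ShortComplex.mk _ _ w₂).ShortExact :=
    HomologicalComplex.shortExact_of_degreewise_shortExact _ hι
  have hz (i : ℤ) (hi : IsZero (C.X i)) : IsZero (kernel (C.d i (i + 1))) :=
    IsZero.of_mono (kernel.ι _) hi
  have hZ' : HasLevel M 0 (zeroDiff (fun i => kernel (C.d i (i + 1)))) :=
    hasLevel_zeroDiff _ (fun i => hM _ (hZ i))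
      (hC.of_isZero hz)
  have hC' : HasLevel M 0 (zeroDiff C.X) :=
    hasLevel_zeroDiff _ (fun i => hM _ (h₀ i)) hC
  refine HasLevel.of_shortExact hS₁ hZ' ?_
  exact imageLevel_succ_of_distTriang' _ _
    (Pretriangulated.rot_of_distTriang _ (triangleOfSES_distinguished hS₂)) hC'
    (prop_map_shift _ hZ' 1)

/-- If `S` is a family of projectives mapping onto the cycles of `C`, then the cycles of the cone
of `S ⟶ C` are syzygies of those of `C`. Hence each such cone lowers the dimension of the cycles
by one, at the cost of one level. -/
theorem hasLevel_of_cycles (hE : IsSyzygyFiltration E) [EnoughProjectives A] (hM : ∀ X, E 0 X →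
      imageLevel (Bounded.ι (C := A)) M 0 ((singleFunctor A 0).obj X))
    (k : ℕ) (C : CochainComplex A ℤ) (hC : IsBoundedComplex C)
    (h₀ : ∀ i, E 0 (C.X i)) (hZ : ∀ i, E k (kernel (C.d i (i + 1)))) : HasLevel M (k + 2) C := by
  induction k generalizing C with
  | zero => exact hasLevel_two hM C hC h₀ hZ
  | succ k ih =>
    choose S q hS hq hz using fun i => exists_projective_epi (kernel (C.d i (i + 1)))
    have hz' (i : ℤ) (hi : IsZero (C.X i)) : IsZero (S i) :=
      hz i (IsZero.of_mono (kernel.ι _) hi)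
    have hs (i : ℤ) : (q i ≫ kernel.ι _) ≫ C.d i (i + 1) = 0 := by simp
    have hS' : HasLevel M 0 (zeroDiff (fun i => S (i + 1))) := by
      refine hasLevel_zeroDiff _ (fun i => hM _ (hE.projective (hS _))) ?_
      obtain ⟨a, b, hab⟩ := hC
      exact ⟨a - 1, b, fun i hi => hz' _ (hab _ (by omega))⟩
    refine HasLevel.of_shortExact_left (attach_shortExact C S _ hs) (ih _ ?_ ?_ ?_) hS'
    · exact isBoundedComplex_attach C S _ hs hC hz'
    · exact fun i => hE.biprod (hE.projective (hS _)) (h₀ _)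
    · intro i
      obtain ⟨T, hT, h₁, h₂, h₃⟩ := attach_cycles_shortExact C S _ hs q (fun _ => rfl) i
      have := hE.of_shortExact hT (k := k)
      rw [h₁, h₂, h₃] at this
      exact this (hE.biprod (hE.projective (hS _)) (h₀ _)) (hZ _)

theorem triangEnvelopeIter_eq_top (hE : IsSyzygyFiltration E) [EnoughProjectives A]
    (hM : ∀ X, E 0 X →
      imageLevel (Bounded.ι (C := A)) M 0 ((singleFunctor A 0).obj X))
    (k : ℕ) (hk : ∀ X, E (k + 2) X) :
    (ObjectProperty.singleton M).triangEnvelopeIter (k + 2) = ⊤ := by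
  have key (C : CochainComplex A ℤ) (hC : IsBoundedComplex C) : HasLevel M (k + 2) C := by
    refine hasLevel_of_terms hE (fun C hC h₀ => ?_) (k + 2) C hC (fun i => hk _)
    refine hasLevel_of_cycles hE hM k C hC h₀ fun i => ?_
    -- For a complex with terms in `E 0`, the cycles are second syzygies of cokernels.
    have h₁ : E (k + 1) (Abelian.image (C.d i (i + 1))) :=
      hE.of_shortExact (S := ShortComplex.mk (Abelian.image.ι (C.d i (i + 1)))
        (cokernel.π (C.d i (i + 1))) (by simp))
        { exact := ShortComplex.exact_of_f_is_kernel _ (kernelIsKernel _) } (h₀ _) (hk _)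
    obtain ⟨w, hw⟩ := shortExact_kernel_of_fac (Abelian.image.fac (C.d i (i + 1))).symm
    exact hE.of_shortExact hw (h₀ i) h₁
  rw [eq_top_iff]
  intro X _
  obtain ⟨C, hC, ⟨e⟩⟩ := exists_isBoundedComplex X
  obtain ⟨Y, hY, ⟨e'⟩⟩ := (ObjectProperty.prop_map_iff _ _ _).1 (key C hC)
  exact ObjectProperty.prop_of_iso _ (Bounded.ι.preimageIso (e' ≪≫ e.symm)) hY

end Bound

/-! ### Vanishing of `Ext` into a fixed object -/

section ExtVanishing

open Abelian

variable {A : Type u} [Category.{v} A] [Abelian A] [HasExt.{w} A]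

/-- `Ext^i(X, L) = 0` for all `i > k`. -/
def ExtVanishesAbove (L : A) (k : ℕ) : ObjectProperty A := fun X =>
  ∀ i, k < i → Subsingleton (Ext X L i)

variable {L : A} {k : ℕ} {S : ShortComplex A} (hS : S.ShortExact)

theorem ExtVanishesAbove.mono {X : A} {l : ℕ} (h : ExtVanishesAbove L k X) (hkl : k ≤ l) :
    ExtVanishesAbove L l X :=
  fun i hi => h i (hkl.trans_lt hi)

theorem extVanishesAbove_of_projective (P : A) [Projective P] : ExtVanishesAbove L 0 P := by
  rintro (_ | i) hi
  · omega
  · exact Ext.subsingleton_of_projective P L i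

include hS

theorem subsingleton_ext_left {i : ℕ} (h₂ : Subsingleton (Ext S.X₂ L i))
    (h₃ : Subsingleton (Ext S.X₃ L (i + 1))) : Subsingleton (Ext S.X₁ L i) := by
  refine subsingleton_of_forall_eq 0 fun x => ?_
  obtain ⟨y, rfl⟩ := Ext.contravariant_sequence_exact₁ hS L x (add_comm 1 i)
    (Subsingleton.elim _ _)
  rw [Subsingleton.elim y 0, Ext.comp_zero]

theorem ExtVanishesAbove.left (h₂ : ExtVanishesAbove L 0 S.X₂)
    (h₃ : ExtVanishesAbove L (k + 1) S.X₃) : ExtVanishesAbove L k S.X₁ :=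
  fun i hi => subsingleton_ext_left hS (h₂ i (by omega)) (h₃ (i + 1) (by omega))

theorem ExtVanishesAbove.middle (h₁ : ExtVanishesAbove L k S.X₁)
    (h₃ : ExtVanishesAbove L k S.X₃) : ExtVanishesAbove L k S.X₂ := by
  refine fun i hi => subsingleton_of_forall_eq 0 fun x => ?_
  have := h₁ i hi
  have := h₃ i hi
  obtain ⟨y, rfl⟩ := Ext.contravariant_sequence_exact₂ hS L x (Subsingleton.elim _ _)
  rw [Subsingleton.elim y 0, Ext.comp_zero]

theorem exists_extension (h₃ : Subsingleton (Ext S.X₃ L 1)) (f : S.X₁ ⟶ L) :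
    ∃ g : S.X₂ ⟶ L, S.f ≫ g = f := by
  obtain ⟨y, hy⟩ := Ext.contravariant_sequence_exact₁ hS L (Ext.mk₀ f) (add_zero 1)
    (Subsingleton.elim _ _)
  obtain ⟨g, rfl⟩ := (Ext.mk₀_bijective _ _).2 y
  exact ⟨g, (Ext.mk₀_bijective _ _).1 (by rw [← hy, Ext.mk₀_comp_mk₀])⟩

theorem ExtVanishesAbove.right (h₁ : ExtVanishesAbove L 0 S.X₁) (h₂ : ExtVanishesAbove L 0 S.X₂)
    (h : ∀ f : S.X₁ ⟶ L, ∃ g : S.X₂ ⟶ L, S.f ≫ g = f) : ExtVanishesAbove L 0 S.X₃ := by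
  refine fun i hi => subsingleton_of_forall_eq 0 fun x => ?_
  obtain ⟨i, rfl⟩ : ∃ j, i = j + 1 := ⟨i - 1, by omega⟩
  have := h₂ (i + 1) hi
  obtain ⟨y, rfl⟩ := Ext.contravariant_sequence_exact₃ hS L x (Subsingleton.elim _ _)
    (add_comm 1 i)
  rcases i with _ | i
  · obtain ⟨f, rfl⟩ := (Ext.mk₀_bijective _ _).2 y
    obtain ⟨g, rfl⟩ := h f
    rw [← Ext.mk₀_comp_mk₀, ← Ext.comp_assoc_of_second_deg_zero]
    simp
  · have := h₁ (i + 1) (by omega)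
    rw [Subsingleton.elim y 0, Ext.comp_zero]

end ExtVanishing

/-! ### Gorenstein-projective objects from sequences of syzygies -/

theorem exists_int_sequence {α : Type*} {r : α → α → Prop} (h₁ : ∀ x, ∃ y, r x y)
    (h₂ : ∀ x, ∃ y, r y x) (x : α) : ∃ s : ℤ → α, s 1 = x ∧ ∀ n, r (s n) (s (n + 1)) := by
  choose f hf using h₁
  choose g hg using h₂
  let t : ℤ → α
    | .ofNat n => f^[n] x
    | .negSucc n => g^[n + 1] x
  have ht (n : ℤ) : r (t n) (t (n + 1)) := by
    match n with
    | .ofNat n =>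
      change r (f^[n] x) (f^[n + 1] x)
      rw [Function.iterate_succ_apply']
      exact hf _
    | .negSucc 0 => exact hg x
    | .negSucc (n + 1) =>
      change r (g^[n + 1 + 1] x) (g^[n + 1] x)
      rw [Function.iterate_succ_apply' g (n + 1)]
      exact hg _
  refine ⟨fun n => t (n - 1), rfl, fun n => ?_⟩
  have := ht (n - 1)
  rwa [show n - 1 + 1 = n + 1 - 1 by ring] at this

section CompleteResolution

variable {A : Type u} [Category.{v} A] [Abelian A]

/-- `Y` is a good syzygy of `X`: there is a short exact sequence `0 ⟶ Y ⟶ P ⟶ X ⟶ 0` with `P`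
projective along which morphisms from `Y` to projective objects extend. -/
def IsGoodSyzygy (X Y : A) : Prop :=
  ∃ (P : A) (f : Y ⟶ P) (g : P ⟶ X) (w : f ≫ g = 0), (ShortComplex.mk f g w).ShortExact ∧
    Projective P ∧ ∀ (Q : A), Projective Q → ∀ t : Y ⟶ Q, ∃ t' : P ⟶ Q, f ≫ t' = t

/-- A two-sided sequence of good syzygies splices to a complete projective resolution. -/
theorem isGorensteinProjective_of_isGoodSyzygy {x : ℤ → A}
    (hx : ∀ n, IsGoodSyzygy (x n) (x (n + 1))) : IsGorensteinProjective (x 1) := by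
  choose P f g w hS hP hQ using hx
  have hm (n) : Mono (f n) := (hS n).mono_f
  have he (n) : Epi (g n) := (hS n).epi_g
  let C : ChainComplex A ℤ := ChainComplex.of P (fun n => g (n + 1) ≫ f n) (fun n => by
    rw [Category.assoc, ← Category.assoc (f (n + 1)), w, zero_comp, comp_zero])
  have hd (n : ℤ) : C.d (n + 1) n = g (n + 1) ≫ f n :=
    ChainComplex.of_d P (fun n => g (n + 1) ≫ f n) n
  have lift (n : ℤ) {B : A} (y : B ⟶ P n) (hy : y ≫ g n = 0) : ∃ z, z ≫ f n = y :=
    ⟨(hS n).exact.lift y hy, (hS n).exact.lift_f y hy⟩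
  have desc (n : ℤ) {B : A} (y : P n ⟶ B) (hy : f n ≫ y = 0) : ∃ z, g n ≫ z = y :=
    ⟨(hS n).exact.desc y hy, (hS n).exact.g_desc y hy⟩
  refine ⟨C, hP, fun n => ?_, fun Q hQ' n t ht => ?_, ?_⟩
  · obtain ⟨m, rfl⟩ : ∃ m, n = m + 1 := ⟨n - 1, by omega⟩
    rw [HomologicalComplex.exactAt_iff' _ (m + 1 + 1) (m + 1) m (by simp) (by simp),
      ShortComplex.exact_iff_exact_up_to_refinements]
    intro B y hy
    change B ⟶ P (m + 1) at y
    replace hy : y ≫ g (m + 1) ≫ f m = 0 := (congrArg (fun t => y ≫ t) (hd m)).symm.trans hy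
    rw [← Category.assoc] at hy
    obtain ⟨z, hz⟩ := lift (m + 1) y ((cancel_mono (f m)).1 (hy.trans zero_comp.symm))
    obtain ⟨B', π, hπ, z', hz'⟩ := surjective_up_to_refinements_of_epi (g (m + 1 + 1)) z
    refine ⟨B', π, hπ, z', ?_⟩
    refine Eq.trans ?_ (congrArg (fun t => z' ≫ t) (hd (m + 1))).symm
    exact (by rw [← hz, reassoc_of% hz'] :
      (π ≫ y : B' ⟶ P (m + 1)) = z' ≫ g (m + 1 + 1) ≫ f (m + 1))
  · have key (j : ℤ) (hj : j + 1 = n) : ∃ t' : C.X j ⟶ Q, C.d n j ≫ t' = t := by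
      subst hj
      rw [hd, Category.assoc] at ht
      obtain ⟨s, hs⟩ := desc (j + 1) t ((cancel_epi (g (j + 1 + 1))).1 (ht.trans comp_zero.symm))
      obtain ⟨t', ht'⟩ := hQ j Q hQ' s
      refine ⟨t', ?_⟩
      rw [hd, Category.assoc, ht', hs]
    exact key _ (by ring)
  · have key (n j : ℤ) (hj : j + 1 = n) : Nonempty (x (n + 1) ≅ kernel (C.d n j)) := by
      subst hj
      exact ⟨(hS (j + 1)).fIsKernel.conePointUniqueUpToIso (kernelIsKernel (g (j + 1))) ≪≫
        (kernelCompMono (g (j + 1)) (f j)).symm ≪≫ (kernelIsoOfEq (hd j)).symm⟩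
    exact key 0 (-1) rfl

end CompleteResolution

/-! ### Duality between left and right modules -/

section Dual

theorem exists_comp_eq_of_ker_le {R M N P : Type*} [Ring R] [AddCommGroup M] [AddCommGroup N]
    [AddCommGroup P] [Module R M] [Module R N] [Module R P] {f : M →ₗ[R] N}
    (hf : Function.Surjective f) {g : M →ₗ[R] P} (h : LinearMap.ker f ≤ LinearMap.ker g) :
    ∃ l : N →ₗ[R] P, l ∘ₗ f = g := by
  refine ⟨(LinearMap.ker f).liftQ g h ∘ₗ (f.quotKerEquivOfSurjective hf).symm.toLinearMap, ?_⟩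
  ext x
  have : (f.quotKerEquivOfSurjective hf).symm (f x) = (LinearMap.ker f).mkQ x := by
    rw [LinearEquiv.symm_apply_eq]
    rfl
  simp only [LinearMap.comp_apply, LinearEquiv.coe_coe, this]
  exact (LinearMap.ker f).liftQ_apply g x

variable {Λ : Type u} [Ring Λ]

/-- Precomposition with `f`, as a morphism of right modules between the `Λ`-duals. -/
def dualPrecomp {X Y : Type u} [AddCommGroup X] [Module Λ X] [AddCommGroup Y] [Module Λ Y]
    (f : X →ₗ[Λ] Y) : (Y →ₗ[Λ] Λ) →ₗ[Λᵐᵒᵖ] (X →ₗ[Λ] Λ) where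
  toFun φ := φ ∘ₗ f
  map_add' _ _ := rfl
  map_smul' _ _ := rfl

theorem exists_linearMap_extension {X : Type u} [AddCommGroup X] [Module Λ X] {n : ℕ}
    {π : (Fin n → Λ) →ₗ[Λ] X} (hπ : Function.Surjective π)
    (hX : ExtVanishesAbove (ModuleCat.of Λ Λ) 0 (ModuleCat.of Λ X))
    (φ : LinearMap.ker π →ₗ[Λ] Λ) :
    ∃ ψ : (Fin n → Λ) →ₗ[Λ] Λ, ψ ∘ₗ (LinearMap.ker π).subtype = φ := by
  obtain ⟨g, hg⟩ := exists_extension (L := ModuleCat.of Λ Λ)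
    (LinearMap.shortExact_shortComplexKer hπ) (hX 1 one_pos) (ModuleCat.ofHom φ)
  exact ⟨g.hom, congrArg ModuleCat.Hom.hom hg⟩

theorem extVanishesAbove_ker {X : Type u} [AddCommGroup X] [Module Λ X] {n : ℕ}
    {π : (Fin n → Λ) →ₗ[Λ] X} (hπ : Function.Surjective π)
    (hX : ExtVanishesAbove (ModuleCat.of Λ Λ) 0 (ModuleCat.of Λ X)) :
    ExtVanishesAbove (ModuleCat.of Λ Λ) 0 (ModuleCat.of Λ (LinearMap.ker π)) := by
  have : Projective (ModuleCat.of Λ (Fin n → Λ)) := inferInstance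
  exact ExtVanishesAbove.left (LinearMap.shortExact_shortComplexKer hπ)
    (extVanishesAbove_of_projective (ModuleCat.of Λ (Fin n → Λ))) (hX.mono zero_le_one)

/-- The short complex dual to `0 ⟶ ker π ⟶ Λⁿ ⟶ X ⟶ 0`. -/
def dualShortComplex {X : Type u} [AddCommGroup X] [Module Λ X] {n : ℕ}
    (π : (Fin n → Λ) →ₗ[Λ] X) : ShortComplex (ModuleCat.{u} Λᵐᵒᵖ) :=
  ShortComplex.moduleCatMk (dualPrecomp π) (dualPrecomp (LinearMap.ker π).subtype) (by
    ext φ x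
    simp [dualPrecomp])

theorem dualShortComplex_shortExact {X : Type u} [AddCommGroup X] [Module Λ X] {n : ℕ}
    {π : (Fin n → Λ) →ₗ[Λ] X} (hπ : Function.Surjective π)
    (hX : ExtVanishesAbove (ModuleCat.of Λ Λ) 0 (ModuleCat.of Λ X)) :
    (dualShortComplex π).ShortExact where
  exact := by
    rw [ShortComplex.moduleCat_exact_iff]
    intro (ψ : (Fin n → Λ) →ₗ[Λ] Λ) hψ
    replace hψ : ψ ∘ₗ (LinearMap.ker π).subtype = 0 := hψ
    have hker : LinearMap.ker π ≤ LinearMap.ker ψ := fun x hx =>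
      LinearMap.congr_fun hψ ⟨x, hx⟩
    exact exists_comp_eq_of_ker_le hπ hker
  mono_f := (ModuleCat.mono_iff_injective _).2 fun φ ψ h => by
    replace h : (φ : X →ₗ[Λ] Λ) ∘ₗ π = (ψ : X →ₗ[Λ] Λ) ∘ₗ π := h
    exact (LinearMap.cancel_right hπ).1 h
  epi_g := (ModuleCat.epi_iff_surjective _).2 fun φ => exists_linearMap_extension hπ hX φ

/-- The dual of `Λⁿ` is `Λⁿ` with its right module structure, so it is free. -/
theorem projective_dual_pi (n : ℕ) :
    Projective (ModuleCat.of Λᵐᵒᵖ ((Fin n → Λ) →ₗ[Λ] Λ)) := by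
  let e : Λᵐᵒᵖ ≃ₗ[Λᵐᵒᵖ] Λ :=
    { toFun := MulOpposite.unop
      map_add' := fun _ _ => rfl
      map_smul' := fun _ _ => rfl
      invFun := MulOpposite.op
      left_inv := fun _ => rfl
      right_inv := fun _ => rfl }
  have : Module.Projective Λᵐᵒᵖ (Fin n → Λ) :=
    Module.Projective.of_equiv (LinearEquiv.piCongrRight fun _ : Fin n => e)
  have := Module.Projective.of_equiv ((Pi.basisFun Λ (Fin n)).constr (M' := Λ) Λᵐᵒᵖ)
  exact (IsProjective.iff_projective _).1 this

/-- If `Ext^i(X, Λ) = 0` for all `i > 0`, then the dual of `X` is a `j`-th syzygy of the dual of a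
`j`-th syzygy of `X`, for every `j`. So `Ext^i(Hom(X, Λ), Λ)` for `i > 0` is isomorphic to an
`Ext` group of arbitrarily high degree, and vanishes because `Λ` has finite injective dimension
as a right module. -/
theorem subsingleton_ext_dual {d : ℕ} (hd : HasInjectiveDimensionLE (ModuleCat.of Λᵐᵒᵖ Λ) d)
    [IsNoetherianRing Λ] {X : Type u} [AddCommGroup X] [Module Λ X] [Module.Finite Λ X]
    (hX : ExtVanishesAbove (ModuleCat.of Λ Λ) 0 (ModuleCat.of Λ X)) (i : ℕ) :
    Subsingleton (Abelian.Ext (ModuleCat.of Λᵐᵒᵖ (X →ₗ[Λ] Λ)) (ModuleCat.of Λᵐᵒᵖ Λ) (i + 1)) := by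
  obtain ⟨j, hj⟩ : ∃ j, d ≤ i + j := ⟨d, by omega⟩
  induction j generalizing i X with
  | zero => exact hd.subsingleton _ _ _ (by omega) _
  | succ j ih =>
    obtain ⟨n, π, hπ⟩ := Module.Finite.exists_fin' Λ X
    have := projective_dual_pi (Λ := Λ) n
    exact subsingleton_ext_left (dualShortComplex_shortExact hπ hX)
      (extVanishesAbove_of_projective (ModuleCat.of Λᵐᵒᵖ ((Fin n → Λ) →ₗ[Λ] Λ)) _ (by omega))
      (ih (extVanishesAbove_ker hπ hX) (i + 1) (by omega))

/-- Every right linear functional on the dual of `Λⁿ` is an evaluation. -/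
theorem exists_eq_eval {n : ℕ} (E : ((Fin n → Λ) →ₗ[Λ] Λ) →ₗ[Λᵐᵒᵖ] Λ) :
    ∃ q : Fin n → Λ, ∀ ψ, E ψ = ψ q := by
  refine ⟨fun i => E (LinearMap.proj i), fun ψ => ?_⟩
  have hψ : ψ = ∑ i, MulOpposite.op (ψ (Pi.single i 1)) •
      (LinearMap.proj i : (Fin n → Λ) →ₗ[Λ] Λ) := by
    refine (Pi.basisFun Λ (Fin n)).ext fun j => ?_
    simp [LinearMap.sum_apply, Pi.single_apply]
  conv_lhs => rw [hψ]
  conv_rhs => rw [hψ]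
  simp [LinearMap.sum_apply]

/-- Finitely generated modules `X` with `Ext^i(X, Λ) = 0` for all `i > 0` are torsionless. Choose
`Λᵐ ⟶ Λⁿ ⟶ X ⟶ 0` exact, and `p ∈ Λⁿ` over an element `x` killed by all functionals. Evaluation
at `p` factors through the dual of the kernel `K` of `Λⁿ ⟶ X`, and extends from there to the dual of
`Λᵐ`, so it is evaluation at the image of some `q ∈ Λᵐ`. Hence `p` lies in `K`, and `x = 0`. -/
theorem eq_zero_of_forall_dual {d : ℕ} (hd : HasInjectiveDimensionLE (ModuleCat.of Λᵐᵒᵖ Λ) d)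
    [IsNoetherianRing Λ] {X : Type u} [AddCommGroup X] [Module Λ X] [Module.Finite Λ X]
    (hX : ExtVanishesAbove (ModuleCat.of Λ Λ) 0 (ModuleCat.of Λ X)) (x : X)
    (hx : ∀ φ : X →ₗ[Λ] Λ, φ x = 0) : x = 0 := by
  obtain ⟨n, π, hπ⟩ := Module.Finite.exists_fin' Λ X
  obtain ⟨p, rfl⟩ := hπ x
  obtain ⟨m, ρ, hρ⟩ := Module.Finite.exists_fin' Λ (LinearMap.ker π)
  have hK := extVanishesAbove_ker hπ hX
  have hK₂ := extVanishesAbove_ker hρ hK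
  let r := dualPrecomp (LinearMap.ker π).subtype
  have hr : Function.Surjective r := exists_linearMap_extension hπ hX
  -- Evaluation at `p` vanishes on the functionals that restrict to zero on the kernel of `π`,
  -- since these come from functionals on `X`.
  let ev : ((Fin n → Λ) →ₗ[Λ] Λ) →ₗ[Λᵐᵒᵖ] Λ :=
    { toFun := fun φ => φ p
      map_add' := fun _ _ => rfl
      map_smul' := fun _ _ => rfl }
  have hker : LinearMap.ker r ≤ LinearMap.ker ev := fun ψ hψ => by
    obtain ⟨φ, hφ⟩ := (ShortComplex.moduleCat_exact_iff _).1
      (dualShortComplex_shortExact hπ hX).exact ψ hψ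
    rw [LinearMap.mem_ker, ← show (φ : X →ₗ[Λ] Λ) ∘ₗ π = ψ from hφ]
    exact hx φ
  obtain ⟨e, he⟩ := exists_comp_eq_of_ker_le hr hker
  replace he (ψ) : e (r ψ) = ψ p := LinearMap.congr_fun he ψ
  obtain ⟨E, hE⟩ := exists_extension (L := ModuleCat.of Λᵐᵒᵖ Λ) (dualShortComplex_shortExact hρ hK)
    (subsingleton_ext_dual hd hK₂ 0) (ModuleCat.ofHom e)
  replace hE (φ : LinearMap.ker π →ₗ[Λ] Λ) : E.hom (φ ∘ₗ ρ) = e φ :=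
    LinearMap.congr_fun (congrArg ModuleCat.Hom.hom hE) φ
  obtain ⟨q, hq⟩ := exists_eq_eval E.hom
  -- Compare the coordinates of `p` and `ρ q`.
  have hpq : p = ρ q := by
    ext i
    exact (he _).symm.trans ((hE _).symm.trans (hq (r (LinearMap.proj i) ∘ₗ ρ)))
  rw [hpq]
  exact (ρ q).2

/-- The dual of a finitely generated module embeds in a finitely generated free right module, so it is
finitely generated, and a set of generators defines a map to some `Λᵏ` through which all functionals
factor. -/
theorem exists_left_approximation {X : Type u} [AddCommGroup X] [Module Λ X]
    [Module.Finite Λ X] [IsNoetherianRing Λᵐᵒᵖ] :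
    ∃ (k : ℕ) (f : X →ₗ[Λ] (Fin k → Λ)), ∀ φ : X →ₗ[Λ] Λ, ∃ ψ, ψ ∘ₗ f = φ := by
  have : Module.Finite Λᵐᵒᵖ (X →ₗ[Λ] Λ) := by
    obtain ⟨n, π, hπ⟩ := Module.Finite.exists_fin' Λ X
    let e : Λᵐᵒᵖ →ₗ[Λᵐᵒᵖ] Λ :=
      { toFun := MulOpposite.unop
        map_add' := fun _ _ => rfl
        map_smul' := fun _ _ => rfl }
    have : Module.Finite Λᵐᵒᵖ Λ := Module.Finite.of_surjective e MulOpposite.unop_surjective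
    have := Module.Finite.equiv ((Pi.basisFun Λ (Fin n)).constr (M' := Λ) Λᵐᵒᵖ)
    exact Module.Finite.of_injective (dualPrecomp π) fun φ ψ h => (LinearMap.cancel_right hπ).1 h
  obtain ⟨k, f, hf⟩ := Module.Finite.exists_fin (R := Λᵐᵒᵖ) (M := X →ₗ[Λ] Λ)
  refine ⟨k, LinearMap.pi f, fun φ => ?_⟩
  obtain ⟨c, hc⟩ := (Submodule.mem_span_range_iff_exists_fun Λᵐᵒᵖ).1
    (hf ▸ Submodule.mem_top : φ ∈ Submodule.span Λᵐᵒᵖ (Set.range f))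
  refine ⟨∑ i, c i • LinearMap.proj i, ?_⟩
  rw [← hc]
  ext x
  simp [LinearMap.sum_apply]

end Dual

/-! ### Finitely generated modules -/

section FG

variable {Λ : Type u} [Ring Λ] [IsNoetherianRing Λ]

/-- The inclusion of finitely generated modules into all modules. -/
abbrev fgForget (Λ : Type u) [Ring Λ] : FGModuleCat.{u} Λ ⥤ ModuleCat.{u} Λ :=
  forget₂ (FGModuleCat.{u} Λ) (ModuleCat.{u} Λ)

instance : (fgForget Λ).Additive where

theorem fg_epi_of_surjective {X Y : FGModuleCat.{u} Λ} (f : X ⟶ Y)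
    (hf : Function.Surjective f.hom.hom) : Epi f :=
  (fgForget Λ).epi_of_epi_map ((ModuleCat.epi_iff_surjective _).2 hf)

theorem fg_mono_of_injective {X Y : FGModuleCat.{u} Λ} (f : X ⟶ Y)
    (hf : Function.Injective f.hom.hom) : Mono f :=
  (fgForget Λ).mono_of_mono_map ((ModuleCat.mono_iff_injective _).2 hf)

theorem fg_surjective_of_epi {X Y : FGModuleCat.{u} Λ} (f : X ⟶ Y) [Epi f] :
    Function.Surjective f.hom.hom :=
  (ModuleCat.epi_iff_surjective ((fgForget Λ).map f)).1 inferInstance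

instance (n : ℕ) : Projective (FGModuleCat.of Λ (Fin n → Λ)) where
  factors {X Y} f e _ := by
    obtain ⟨g, hg⟩ := Module.projective_lifting_property e.hom.hom f.hom.hom
      (fg_surjective_of_epi e)
    exact ⟨FGModuleCat.ofHom g, FGModuleCat.hom_ext hg⟩

theorem exists_epi_pi (X : FGModuleCat.{u} Λ) :
    ∃ (n : ℕ) (f : FGModuleCat.of Λ (Fin n → Λ) ⟶ X), Epi f := by
  obtain ⟨n, π, hπ⟩ := Module.Finite.exists_fin' Λ X
  exact ⟨n, FGModuleCat.ofHom π, fg_epi_of_surjective _ hπ⟩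

instance : EnoughProjectives (FGModuleCat.{u} Λ) where
  presentation X := by
    obtain ⟨n, f, hf⟩ := exists_epi_pi X
    exact ⟨{ p := _, f := f }⟩

/-- The finitely generated modules `X` with `Ext^i(X, Λ) = 0` for all `i > k`. -/
def fgExtVanishesAbove (Λ : Type u) [Ring Λ] (k : ℕ) : ObjectProperty (FGModuleCat.{u} Λ) :=
  fun X => ExtVanishesAbove (ModuleCat.of Λ Λ) k X.obj

theorem fg_exists_retract_pi {Q : FGModuleCat.{u} Λ} (hQ : Projective Q) :
    ∃ n : ℕ, Nonempty (Retract Q (FGModuleCat.of Λ (Fin n → Λ))) := by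
  obtain ⟨n, f, hf⟩ := exists_epi_pi Q
  exact ⟨n, ⟨⟨Projective.factorThru (𝟙 Q) f, f, by simp⟩⟩⟩

theorem isSyzygyFiltration_fgExtVanishesAbove :
    IsSyzygyFiltration (fgExtVanishesAbove Λ) where
  projective {P} hP := by
    obtain ⟨n, ⟨r⟩⟩ := fg_exists_retract_pi hP
    have : Projective ((fgForget Λ).obj (FGModuleCat.of Λ (Fin n → Λ))) :=
      inferInstanceAs (Projective (ModuleCat.of Λ (Fin n → Λ)))
    have : Projective P.obj := (r.map (fgForget Λ)).projective
    exact extVanishesAbove_of_projective P.obj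
  biprod {X Y} hX hY := ExtVanishesAbove.middle
    ((ShortComplex.Splitting.ofHasBinaryBiproduct X Y).shortExact.map_of_exact (fgForget Λ)) hX hY
  of_shortExact {S} hS k h₂ h₃ := ExtVanishesAbove.left (hS.map_of_exact (fgForget Λ)) h₂ h₃

/-- If the map `f` extends all functionals to `Λ`, it extends all morphisms to projectives. -/
theorem fg_exists_extension {Y P : FGModuleCat.{u} Λ} (f : Y ⟶ P)
    (hf : ∀ φ : Y →ₗ[Λ] Λ, ∃ ψ : P →ₗ[Λ] Λ, ψ ∘ₗ f.hom.hom = φ) (Q : FGModuleCat.{u} Λ)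
    (hQ : Projective Q) (t : Y ⟶ Q) : ∃ t' : P ⟶ Q, f ≫ t' = t := by
  obtain ⟨n, ⟨r⟩⟩ := fg_exists_retract_pi hQ
  choose ψ hψ using fun i => hf (LinearMap.proj i ∘ₗ (t ≫ r.i).hom.hom)
  refine ⟨FGModuleCat.ofHom (LinearMap.pi ψ) ≫ r.r, ?_⟩
  have : f ≫ FGModuleCat.ofHom (LinearMap.pi ψ) = t ≫ r.i := by
    refine FGModuleCat.hom_ext (LinearMap.ext fun x => funext fun i => ?_)
    exact LinearMap.congr_fun (hψ i) x
  rw [← Category.assoc, this, Category.assoc, r.retract, Category.comp_id]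

/-- Morphisms to projectives extend along any projective presentation of `X`, because
`Ext^1(X, Λ) = 0`. -/
theorem exists_isGoodSyzygy {X : FGModuleCat.{u} Λ} (hX : fgExtVanishesAbove Λ 0 X) :
    ∃ Y, fgExtVanishesAbove Λ 0 Y ∧ IsGoodSyzygy X Y := by
  obtain ⟨n, π, hπ⟩ := exists_epi_pi X
  have hS : (ShortComplex.mk (kernel.ι π) π (kernel.condition π)).ShortExact :=
    { exact := ShortComplex.exact_of_f_is_kernel _ (kernelIsKernel π) }
  have hE := isSyzygyFiltration_fgExtVanishesAbove (Λ := Λ)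
  refine ⟨kernel π, hE.of_shortExact hS (hE.projective inferInstance) (hX.mono zero_le_one), _, _,
    _, _, hS, inferInstance, fg_exists_extension _ fun φ => ?_⟩
  obtain ⟨g, hg⟩ := exists_extension (L := ModuleCat.of Λ Λ) (hS.map_of_exact (fgForget Λ))
    (hX 1 one_pos) (ModuleCat.ofHom φ)
  exact ⟨g.hom, congrArg ModuleCat.Hom.hom hg⟩

/-- A left approximation `Y ⟶ Λᵏ` is injective, since `Y` is torsionless, and `Y` is a good syzygy of
its cokernel. -/
theorem exists_isGoodCosyzygy [IsNoetherianRing Λᵐᵒᵖ] {d : ℕ}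
    (hd : HasInjectiveDimensionLE (ModuleCat.of Λᵐᵒᵖ Λ) d) {Y : FGModuleCat.{u} Λ}
    (hY : fgExtVanishesAbove Λ 0 Y) :
    ∃ X, fgExtVanishesAbove Λ 0 X ∧ IsGoodSyzygy X Y := by
  obtain ⟨k, f, hf⟩ := exists_left_approximation (Λ := Λ) (X := Y)
  let f' : Y ⟶ FGModuleCat.of Λ (Fin k → Λ) := FGModuleCat.ofHom f
  have hinj : Function.Injective f := (injective_iff_map_eq_zero _).2 fun y hy =>
    eq_zero_of_forall_dual hd hY y fun φ => by
      obtain ⟨ψ, rfl⟩ := hf φ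
      rw [LinearMap.comp_apply, hy, map_zero]
  have : Mono f' := fg_mono_of_injective _ hinj
  have hS : (ShortComplex.mk f' (cokernel.π f') (cokernel.condition f')).ShortExact :=
    { exact := ShortComplex.exact_of_g_is_cokernel _ (cokernelIsCokernel f') }
  have hE := isSyzygyFiltration_fgExtVanishesAbove (Λ := Λ)
  refine ⟨cokernel f', ExtVanishesAbove.right (hS.map_of_exact (fgForget Λ)) hY
    (show fgExtVanishesAbove Λ 0 (FGModuleCat.of Λ (Fin k → Λ)) from hE.projective inferInstance)
    fun φ => ?_, _, _, _, _, hS, inferInstance,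
    fg_exists_extension _ hf⟩
  obtain ⟨ψ, hψ⟩ := hf φ.hom
  exact ⟨ModuleCat.ofHom ψ, ModuleCat.hom_ext hψ⟩

theorem isGorensteinProjective_of_fgExtVanishesAbove [IsNoetherianRing Λᵐᵒᵖ] {d : ℕ}
    (hd : HasInjectiveDimensionLE (ModuleCat.of Λᵐᵒᵖ Λ) d) {X : FGModuleCat.{u} Λ}
    (hX : fgExtVanishesAbove Λ 0 X) : IsGorensteinProjective X := by
  obtain ⟨s, hs, h⟩ := exists_int_sequence
    (α := {X : FGModuleCat.{u} Λ // fgExtVanishesAbove Λ 0 X})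
    (r := fun X Y => IsGoodSyzygy X.1 Y.1)
    (fun X => by
      obtain ⟨Y, hY, h⟩ := exists_isGoodSyzygy X.2
      exact ⟨⟨Y, hY⟩, h⟩)
    (fun Y => by
      obtain ⟨X, hX, h⟩ := exists_isGoodCosyzygy hd Y.2
      exact ⟨⟨X, hX⟩, h⟩) ⟨X, hX⟩
  have := isGorensteinProjective_of_isGoodSyzygy (x := fun n => (s n).1) h
  rwa [hs] at this

end FG

/-! ### Direct summands in the derived category -/

section AddClosure

variable {A : Type u} [Category.{v} A] [Abelian A] [HasDerivedCategory.{w} A]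

open DerivedCategory

attribute [local instance] Abelian.hasFiniteBiproducts

theorem imageLevel_singleFunctor_retract {M : Bounded A} {X Y : A} (r : Retract X Y)
    (hY : imageLevel (Bounded.ι (C := A)) M 0 ((singleFunctor A 0).obj Y)) :
    imageLevel (Bounded.ι (C := A)) M 0 ((singleFunctor A 0).obj X) :=
  prop_map_retract _ (r.map _) hY
    ⟨⟨(singleFunctor A 0).obj X, ⟨0, inferInstanceAs (IsGE _ 0)⟩, ⟨0, inferInstanceAs (IsLE _ 0)⟩⟩,
      ⟨Iso.refl _⟩⟩

theorem imageLevel_singleFunctor_biproduct {M : Bounded A} {n : ℕ} (F : Fin n → A)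
    (hF : ∀ i, imageLevel (Bounded.ι (C := A)) M 0 ((singleFunctor A 0).obj (F i))) :
    imageLevel (Bounded.ι (C := A)) M 0 ((singleFunctor A 0).obj (⨁ F)) := by
  induction n with
  | zero =>
    refine imageLevel_zero _ _ (Functor.map_isZero _ ?_) 0
    rw [IsZero.iff_id_eq_zero]
    exact biproduct.hom_ext _ _ fun i => i.elim0
  | succ n ih =>
    have r : Retract (⨁ F) (F 0 ⊞ ⨁ fun i : Fin n => F i.succ) :=
      retractOfTotal (biproduct.π F 0) (biproduct.ι F 0)
        (biproduct.lift fun i => biproduct.π F i.succ)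
        (biproduct.desc fun i => biproduct.ι F i.succ) (by
          rw [biproduct.lift_desc, ← Fin.sum_univ_succ (fun i => biproduct.π F i ≫ biproduct.ι F i),
            biproduct.total])
    refine imageLevel_singleFunctor_retract r ?_
    have := preservesBinaryBiproducts_of_preservesBiproducts (singleFunctor A 0)
    refine ObjectProperty.prop_of_iso (imageLevel _ M 0)
      ((singleFunctor A 0).mapBiprod (F 0) (⨁ fun i : Fin n => F i.succ)).symm
      (imageLevel_biprod _ _ (hF 0) (ih _ fun i => hF i.succ))

end AddClosure

/-! ### The derived dimension -/

theorem IsArtinAlgebra.isNoetherianRing_op (Λ : Type u) [Ring Λ] [h : IsArtinAlgebra Λ] :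
    IsNoetherianRing Λᵐᵒᵖ := by
  obtain ⟨R, _, _, _, _⟩ := h.exists_finite
  have : Module.Finite R Λᵐᵒᵖ := Module.Finite.equiv (MulOpposite.opLinearEquiv R)
  exact isNoetherian_of_tower R (inferInstance : IsNoetherian R Λᵐᵒᵖ)

theorem mainTheorem6 (Λ : Type u) [Ring Λ] [IsArtinAlgebra Λ]
    [HasDerivedCategory.{w} (FGModuleCat.{u} Λ)] (d : ℕ)
    (hd : IsGorensteinOfDim Λ d) (hCM : IsFiniteCMType Λ) :
    derDim.{w} Λ ≤ max 2 (d : ℕ∞) := by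
  have := IsArtinAlgebra.isNoetherianRing_op Λ
  obtain ⟨G, -, hG⟩ := hCM
  -- With `max 2 d = k + 2`, all modules have `Ext^i(-, Λ) = 0` for `i > k + 2`.
  obtain ⟨k, hk⟩ : ∃ k, max 2 d = k + 2 := ⟨max 2 d - 2, by omega⟩
  let M : DerivedCategory.Bounded (FGModuleCat.{u} Λ) :=
    ⟨(DerivedCategory.singleFunctor _ 0).obj G, ⟨0, inferInstanceAs (DerivedCategory.IsGE _ 0)⟩,
      ⟨0, inferInstanceAs (DerivedCategory.IsLE _ 0)⟩⟩
  have hM (X : FGModuleCat.{u} Λ) (hX : fgExtVanishesAbove Λ 0 X) :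
      imageLevel (DerivedCategory.Bounded.ι (C := FGModuleCat.{u} Λ)) M 0
        ((DerivedCategory.singleFunctor _ 0).obj X) := by
    have hX' : addClosure IsGorensteinProjective X :=
      ⟨1, fun _ => X, fun _ => isGorensteinProjective_of_fgExtVanishesAbove hd.right.1 hX,
        ⟨⟨biproduct.ι (fun _ : Fin 1 => X) 0, biproduct.π (fun _ : Fin 1 => X) 0,
          biproduct.ι_π_self _ _⟩⟩⟩
    rw [hG] at hX'
    obtain ⟨n, F, hF, ⟨r⟩⟩ := hX'
    refine imageLevel_singleFunctor_retract r (imageLevel_singleFunctor_biproduct F fun i => ?_)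
    rw [← (ObjectProperty.singleton_iff _ _).1 (hF i)]
    exact ObjectProperty.prop_map_obj _ _ (ObjectProperty.le_triangEnvelopeIter _ 0 _
      ((ObjectProperty.singleton_iff M M).2 rfl))
  have htop := triangEnvelopeIter_eq_top isSyzygyFiltration_fgExtVanishesAbove hM k
    fun X i hi => hd.left.1.subsingleton _ _ i (by omega) _
  calc derDim.{w} Λ ≤ ((k + 2 : ℕ) : ℕ∞) := iInf₂_le _ ⟨M, htop⟩
    _ = max 2 (d : ℕ∞) := by rw [← hk]; exact Nat.mono_cast.map_max
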